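/- Let $\mathcal Z$ be a measurable space (for example a closed subset of $\mathbb R^m$) and let $\mathbb G$ be a separable reproducing kernel Hilbert space of real functions on $\mathcal Z$ with kernel $l$ and canonical feature map $\varphi(z)=l(\cdot,z)\in\mathbb G$. Assume that $\varphi$ is measurable, that $\int\|\varphi(z)\|^2\,d\pi(z)<\infty$ for every probability measure $\pi$ on $\mathcal Z$, and that $\mathbb G$ is closed under pointwise multiplication with bounded multiplication: $f\cdot g\in\mathbb G$ and $\|f\cdot g\|\le C\|f\|\,\|g\|$ for all $f,g\in\mathbb G$, for some constant $C$. Let $\mathbb G\otimes\mathbb G$ and $\mathbb G^{\otimes N}$ denote Hilbert space tensor products, and identify $x\in\mathbb G\otimes\mathbb G$ with the Hilbert–Schmidt operator on $\mathbb G$ given by $\langle x\,c,d\rangle=\langle x,d\otimes c\rangle$, so that $(a\otimes b)c=\langle b,c\rangle a$. For $f\in\mathbb G$ let $Tf$ be the bounded operator on $\mathbb G$ with $$\langle [Tf]g,k\rangle=\langle f,\,k\cdot g\rangle\qquad(g,k\in\mathbb G),$$ i.e. $T$ is the adjoint of the multiplication map $k\otimes g\mapsto k\cdot g$, its values being read as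 operators on $\mathbb G$. Let $N\ge 2$ and let $Z^1,\dots,Z^N$ be a time-homogeneous Markov chain in $\mathcal Z$ with transition Markov kernel $u$. Assume that there is a well-specified transition conditional mean embedding operator, i.e. a Hilbert–Schmidt operator $U:\mathbb G\to\mathbb G$ with $$U\varphi(z)=\int_{\mathcal Z}\varphi(z')\,u(z,dz')\qquad\text{for all } z\in\mathcal Z,$$ and let $U=\sum_{i\in\mathbb N}\lambda_i\,h_i\otimes g_i$ be any decomposition with $\lambda_i\in\mathbb R$ and $h_i,g_i\in\mathbb G$, the series converging in Hilbert–Schmidt norm (finite sums are included by taking $\lambda_i=0$ from some index on). Put $\mu_{Z^1}=\mathbb E[\varphi(Z^1)]$, $b_i=[T\mu_{Z^1}]g_i\in\mathbb G$ and $w_{i,j}=[Th_i]g_j\in\mathbb G$. Then $\varphi(Z^1)\otimes\cdots\otimes\varphi(Z^N)$ is Bochner integrable, and the mean embedding $\mu_{Z^{1:N}}=\mathbb E[\varphi(Z^1)\otimes\cdots\otimes\varphi(Z^N)]\in\mathbb G^{\otimes N}$ satisfies $$\mu_{Z^{1:N}}=\sum_{i_2,\dots,i_N} b_{i_2}\otimes\lambda_{i_2}w_{i_2,i_3}\otimes\cdots\otimes\lambda_{i_{N-1}}w_{i_{N-1},i_N}\otimes\lambda_{i_N}h_{i_N},$$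 where the sum is the limit in $\mathbb G^{\otimes N}$ of the partial sums over the boxes $\{i_n<R_n,\ n=2,\dots,N\}$ as $R_2,\dots,R_N\to\infty$ jointly. If the $h_i$ are pairwise orthogonal (as in a singular value decomposition), the family of all summands, indexed by $\mathbb N^{N-1}$, is moreover unconditionally summable with sum $\mu_{Z^{1:N}}$. Finally, if $T^*:\mathbb G\otimes\mathbb G\to\mathbb G$ is a bounded operator on the Hilbert space tensor product with $T^*(f\otimes k)=f\cdot k$ for all $f,k\in\mathbb G$, then with its Hilbert space adjoint $(T^*)^*:\mathbb G\to\mathbb G\otimes\mathbb G$ one has $b_i=[(T^*)^*\mu_{Z^1}]g_i$ and $w_{i,j}=[(T^*)^*h_i]g_j$, through the above identification of tensors with operators. -/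

import Mathlib

open MeasureTheory ProbabilityTheory Filter Topology
open scoped TensorProduct InnerProductSpace

noncomputable section

set_option linter.unusedSectionVars false

namespace SpectralMeanFlow

universe u v w

/-! ### Hilbert space tensor products -/

section HilbertTensor

/-- A real Hilbert space, bundled so that one can recurse on it. -/
structure HilbertSpaceObj : Type (u + 1) where
  carrier : Type u
  [instNACG : NormedAddCommGroup carrier]
  [instIPS : InnerProductSpace ℝ carrier]
  [instComplete : CompleteSpace carrier]

attribute [instance] HilbertSpaceObj.instNACG HilbertSpaceObj.instIPS HilbertSpaceObj.instComplete

/-- The Hilbert space tensor product of two real Hilbert spaces: the completion of the algebraic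
tensor product for the inner product `⟪a ⊗ b, c ⊗ d⟫ = ⟪a, c⟫ * ⟪b, d⟫`. -/
abbrev HTensor (E F : Type u) [NormedAddCommGroup E] [InnerProductSpace ℝ E]
    [NormedAddCommGroup F] [InnerProductSpace ℝ F] : Type u :=
  UniformSpace.Completion (E ⊗[ℝ] F)

/-- The elementary tensor `a ⊗ b` in the Hilbert space tensor product. -/
def htmul {E F : Type u} [NormedAddCommGroup E] [InnerProductSpace ℝ E]
    [NormedAddCommGroup F] [InnerProductSpace ℝ F] (a : E) (b : F) : HTensor E F :=
  ((a ⊗ₜ[ℝ] b : E ⊗[ℝ] F) : UniformSpace.Completion (E ⊗[ℝ] F))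

/-- `tensorPowObj G n` is the Hilbert space tensor power of `G` with `n + 1` factors,
`G ⊗ (G ⊗ (⋯ ⊗ G))`. -/
def tensorPowObj (G : Type u) [NormedAddCommGroup G] [InnerProductSpace ℝ G] [CompleteSpace G] :
    ℕ → HilbertSpaceObj.{u}
  | 0 => ⟨G⟩
  | n + 1 => ⟨HTensor G (tensorPowObj G n).carrier⟩

/-- The Hilbert space `G^{⊗(n+1)}`. -/
abbrev TensorPow (G : Type u) [NormedAddCommGroup G] [InnerProductSpace ℝ G] [CompleteSpace G]
    (n : ℕ) : Type u :=
  (tensorPowObj G n).carrier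

/-- The elementary tensor `f 0 ⊗ f 1 ⊗ ⋯ ⊗ f n` in `G^{⊗(n+1)}`. -/
def elemTensor {G : Type u} [NormedAddCommGroup G] [InnerProductSpace ℝ G] [CompleteSpace G] :
    (n : ℕ) → (Fin (n + 1) → G) → TensorPow G n
  | 0, f => f 0
  | n + 1, f => htmul (f 0) (elemTensor n (Fin.tail f))

variable {G : Type u} [NormedAddCommGroup G] [InnerProductSpace ℝ G] [CompleteSpace G]

/-- The bounded linear map `a ↦ a ⊗ c` from `G` to `G ⊗ G`. -/
def tensorRight (c : G) : G →L[ℝ] HTensor G G :=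
  (UniformSpace.Completion.toComplL (𝕜 := ℝ) (E := G ⊗[ℝ] G)).comp
    ((TensorProduct.mkL ℝ G G).flip c)

theorem tensorRight_apply (a c : G) : tensorRight c a = htmul a c := rfl

theorem inner_htmul (a b c d : G) :
    ⟪htmul a b, htmul c d⟫_ℝ = ⟪a, c⟫_ℝ * ⟪b, d⟫_ℝ := by
  simp [htmul, UniformSpace.Completion.inner_coe]

theorem norm_tensorRight_le (c : G) : ‖tensorRight c‖ ≤ ‖c‖ := by
  refine ContinuousLinearMap.opNorm_le_bound _ (norm_nonneg _) fun a => ?_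
  rw [tensorRight_apply, htmul, UniformSpace.Completion.norm_coe, TensorProduct.norm_tmul, mul_comm]

/-- The standard identification of tensors with (Hilbert-Schmidt) operators: the operator on `G`
attached to `x ∈ G ⊗ G` sends `c` to the vector `x c` with `⟪x c, d⟫ = ⟪x, d ⊗ c⟫` for all `d`.
On elementary tensors, `(a ⊗ b) c = ⟪b, c⟫ a`. -/
def tensorOp (x : HTensor G G) : G →L[ℝ] G :=
  LinearMap.mkContinuous
    { toFun := fun c => (tensorRight c).adjoint x
      map_add' := fun c c' => by
        refine ext_inner_right ℝ fun d => ?_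
        simp [inner_add_left, ContinuousLinearMap.adjoint_inner_left, tensorRight]
      map_smul' := fun r c => by
        refine ext_inner_right ℝ fun d => ?_
        simp [ContinuousLinearMap.adjoint_inner_left, tensorRight, inner_smul_left] }
    ‖x‖ (fun c => by
      change ‖(tensorRight c).adjoint x‖ ≤ ‖x‖ * ‖c‖
      refine ((tensorRight c).adjoint.le_opNorm x).trans ?_
      rw [show ‖(tensorRight c).adjoint‖ = ‖tensorRight c‖ from
        LinearIsometryEquiv.norm_map _ (tensorRight c), mul_comm]
      exact mul_le_mul_of_nonneg_left (norm_tensorRight_le c) (norm_nonneg _))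

theorem tensorOp_apply (x : HTensor G G) (c : G) :
    tensorOp x c = (tensorRight c).adjoint x := rfl

theorem tensorOp_htmul (a b c : G) : tensorOp (htmul a b) c = ⟪b, c⟫_ℝ • a := by
  refine ext_inner_right ℝ fun d => ?_
  rw [tensorOp_apply, ContinuousLinearMap.adjoint_inner_left, tensorRight_apply, inner_htmul, inner_smul_left]
  simp [mul_comm]

/-- `U = ∑ i, lam i • h i ⊗ g i`: `U` is a Hilbert-Schmidt operator on `G`, and the series converges
to it in the space `S₂(G) ≃ G ⊗ G` of Hilbert-Schmidt operators. Finite sums are the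
case where `lam i = 0` from some index on. -/
def IsDecomposition (U : G →L[ℝ] G) (lam : ℕ → ℝ) (h g : ℕ → G) : Prop :=
  ∃ x : HTensor G G, tensorOp x = U ∧
    Tendsto (fun r : ℕ => ∑ i ∈ Finset.range r, lam i • htmul (h i) (g i)) atTop (𝓝 x)

end HilbertTensor

/-! ### Reproducing kernel Hilbert algebras -/

section RKHA

variable {S : Type v} (G : Type u) [NormedAddCommGroup G] [InnerProductSpace ℝ G]
  [CompleteSpace G] [RKHS ℝ G S ℝ]

/-- The canonical feature map `z ↦ l(·, z)`. -/
def feature (z : S) : G := RKHS.kerFun G z (1 : ℝ)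

/-- The reproducing property. -/
theorem inner_feature (z : S) (f : G) : ⟪feature G z, f⟫_ℝ = f z := by
  simp [feature]

/-- The space of functions `G` is closed under pointwise multiplication, and multiplication is a
bounded bilinear map. -/
structure FormsAlgebra : Prop where
  closed : ∀ f g : G, ∃ p : G, ∀ z, p z = f z * g z
  bounded : ∃ C : ℝ, ∀ f g p : G, (∀ z, p z = f z * g z) → ‖p‖ ≤ C * ‖f‖ * ‖g‖

variable {G}

/-- The pointwise product `f · g ∈ G`. -/
def FormsAlgebra.mul (hG : FormsAlgebra G) (f g : G) : G := (hG.closed f g).choose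

theorem FormsAlgebra.mul_apply (hG : FormsAlgebra G) (f g : G) (z : S) :
    hG.mul f g z = f z * g z := (hG.closed f g).choose_spec z

/-- Pointwise multiplication as a bounded bilinear map. -/
def FormsAlgebra.mulL (hG : FormsAlgebra G) : G →L[ℝ] G →L[ℝ] G :=
  LinearMap.mkContinuous₂
    (LinearMap.mk₂ ℝ hG.mul
      (fun f f' g => by ext z; simp [hG.mul_apply, add_mul])
      (fun c f g => by ext z; simp [hG.mul_apply, mul_assoc])
      (fun f g g' => by ext z; simp [hG.mul_apply, mul_add])
      (fun c f g => by ext z; simp [hG.mul_apply, mul_left_comm]))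
    hG.bounded.choose
    (fun f g => hG.bounded.choose_spec f g (hG.mul f g) (hG.mul_apply f g))

theorem FormsAlgebra.mulL_apply (hG : FormsAlgebra G) (f g : G) (z : S) :
    hG.mulL f g z = f z * g z := hG.mul_apply f g z

/-- The adjoint `T` of multiplication, with its values viewed as operators on `G`: `T f` is the
operator such that `⟪[T f] g, k⟫ = ⟪f, k · g⟫` for all `g, k`, that is, the operator which
represents the functional `k ⊗ g ↦ ⟪f, k · g⟫`. -/
def FormsAlgebra.mulAdjoint (hG : FormsAlgebra G) (f g : G) : G :=
  (hG.mulL.flip g).adjoint f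

theorem FormsAlgebra.inner_mulAdjoint (hG : FormsAlgebra G) (f g k : G) :
    ⟪hG.mulAdjoint f g, k⟫_ℝ = ⟪f, hG.mulL k g⟫_ℝ := by
  simp [mulAdjoint, ContinuousLinearMap.adjoint_inner_left]

end RKHA

/-! ### Markov chains and the tensor train -/

/-- `Z 0, …, Z N` is a time-homogeneous Markov chain under `P` with transition kernel `κ`: the
conditional distribution of `Z (n+1)` given `(Z 0, …, Z n)` is `κ (Z n)`. -/
def IsMarkovChain {S : Type v} {Ω : Type w} [MeasurableSpace S] [MeasurableSpace Ω] {N : ℕ}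
    (Z : Fin (N + 1) → Ω → S) (κ : Kernel S S) (P : Measure Ω) : Prop :=
  ∀ n : Fin N, HasCondDistrib (Z n.succ)
    (fun ω (k : Fin (n.val + 1)) => Z (Fin.castLE (by omega) k) ω)
    (κ.comap (fun past : Fin (n.val + 1) → S => past (Fin.last n.val))
      (measurable_pi_apply _)) P

/-- The factors of one summand of the tensor train with `N + 2` factors and bond indices
`i : Fin (N + 1) → ℕ`: the first is `b (i 0)`, the last is `lam (i N) • h (i N)`, and those between
are `lam (i n) • w (i n) (i (n+1))`. -/
def trainFactors {G : Type u} [AddCommGroup G] [Module ℝ G] {N : ℕ} (lam : ℕ → ℝ) (b : ℕ → G)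
    (w : ℕ → ℕ → G) (h : ℕ → G) (i : Fin (N + 1) → ℕ) : Fin (N + 2) → G :=
  Fin.cons (α := fun _ => G) (b (i 0))
    (Fin.snoc (α := fun _ => G) (fun n : Fin N => lam (i n.castSucc) • w (i n.castSucc) (i n.succ))
      (lam (i (Fin.last N)) • h (i (Fin.last N))))

end SpectralMeanFlow

end

/-! Let `x` be the tensor of `U`. The proof rests on an operator `appendL n x` between tensor
powers, bounded and linear both in `x` and in its argument, which for `x = h ⊗ g` sends `f ⊗ a` to
`f ⊗ [T a] g ⊗ h`. Pairing its output with `f ⊗ a ⊗ c` amounts to pairing its input with `f ⊗ (a ·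
U* c)` (`inner_appendL_elemTensor`). Since `(U* c)(z)` is the integral of `c` against the transition
law at `z`, the Markov property says exactly that `appendL n x` carries the mean embedding of the
chain to that of the chain with one more step (`integral_elemTensor_succ`).

Appending one rank-one term of the decomposition at a time produces a summand of the train
(`trainTerm_eq_elemTensor`). By bilinearity, a box sum is the operator of a partial sum of the
series applied to a smaller box sum (`sum_trainTerm_succ`), so joint continuity gives the limit by
induction on the length.

If the `h i` are orthogonal, the operators of the single terms have orthogonal ranges and square
summable norms, and summability propagates along the chain (`summable_of_orthogonal_operators`). The
boxes exhaust the index set, so the unconditional sum is the box limit. -/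

noncomputable section

set_option linter.unusedSectionVars false

namespace SpectralMeanFlow

universe u v w

/-! ### Operators acting on one leg of a Hilbert space tensor product. -/

section HilbertTensorMaps

variable {E F E' F' : Type u} [NormedAddCommGroup E] [InnerProductSpace ℝ E]
  [NormedAddCommGroup F] [InnerProductSpace ℝ F] [NormedAddCommGroup E'] [InnerProductSpace ℝ E']
  [NormedAddCommGroup F'] [InnerProductSpace ℝ F']

theorem inner_htmul_htmul (a c : E) (b d : F) :
    ⟪htmul a b, htmul c d⟫_ℝ = ⟪a, c⟫_ℝ * ⟪b, d⟫_ℝ := by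
  simp [htmul, UniformSpace.Completion.inner_coe]

theorem norm_htmul (a : E) (b : F) : ‖htmul a b‖ = ‖a‖ * ‖b‖ := by
  rw [htmul, UniformSpace.Completion.norm_coe, TensorProduct.norm_tmul]

/-- The elementary tensor as a bounded bilinear map. -/
def htmulL (E F : Type u) [NormedAddCommGroup E] [InnerProductSpace ℝ E]
    [NormedAddCommGroup F] [InnerProductSpace ℝ F] : E →L[ℝ] F →L[ℝ] HTensor E F :=
  (ContinuousLinearMap.compL ℝ F (E ⊗[ℝ] F) (HTensor E F)
    (UniformSpace.Completion.toComplL (𝕜 := ℝ) (E := E ⊗[ℝ] F))).comp (TensorProduct.mkL ℝ E F)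

theorem htmulL_apply (a : E) (b : F) : htmulL E F a b = htmul a b := rfl

/-- Bounded operators on the Hilbert space tensor product are determined by their values on
elementary tensors. -/
theorem HTensor.clm_ext {X : Type*} [NormedAddCommGroup X] [NormedSpace ℝ X]
    {A B : HTensor E F →L[ℝ] X} (h : ∀ a b, A (htmul a b) = B (htmul a b)) : A = B := by
  ext x
  induction x using UniformSpace.Completion.induction_on with
  | hp => exact isClosed_eq A.continuous B.continuous
  | ih x =>
    induction x using TensorProduct.induction_on with
    | zero => simp [UniformSpace.Completion.coe_zero]
    | tmul a b => exact h a b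
    | add x y hx hy => simp only [UniformSpace.Completion.coe_add, map_add, hx, hy]

theorem norm_completion_le {X Y : Type*} [NormedAddCommGroup X] [NormedSpace ℝ X]
    [NormedAddCommGroup Y] [NormedSpace ℝ Y] (A : X →L[ℝ] Y) : ‖A.completion‖ ≤ ‖A‖ := by
  refine ContinuousLinearMap.opNorm_le_bound _ (norm_nonneg _) fun x => ?_
  induction x using UniformSpace.Completion.induction_on with
  | hp => exact isClosed_le (by fun_prop) (by fun_prop)
  | ih x => simpa using A.le_opNorm x

/-- The operator `B ↦ id ⊗ B`. -/
def htLeftL (E F F' : Type u) [NormedAddCommGroup E] [InnerProductSpace ℝ E]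
    [NormedAddCommGroup F] [InnerProductSpace ℝ F] [NormedAddCommGroup F']
    [InnerProductSpace ℝ F'] : (F →L[ℝ] F') →L[ℝ] (HTensor E F →L[ℝ] HTensor E F') :=
  LinearMap.mkContinuous
    { toFun := fun B => (B.lTensor E).completion
      map_add' := fun B C => HTensor.clm_ext fun a b => by
        simp [htmul, UniformSpace.Completion.coe_add]
      map_smul' := fun r B => HTensor.clm_ext fun a b => by
        simp [htmul] }
    1 (fun B => by
      rw [one_mul]
      exact (norm_completion_le _).trans (ContinuousLinearMap.norm_lTensor_le E B))

theorem htLeftL_htmul (B : F →L[ℝ] F') (a : E) (b : F) :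
    htLeftL E F F' B (htmul a b) = htmul a (B b) := by
  simp [htLeftL, htmul]

/-- The operator `A ↦ (c ⊗ a ↦ A a ⊗ c)`. -/
def htSwapL (E F E' : Type u) [NormedAddCommGroup E] [InnerProductSpace ℝ E]
    [NormedAddCommGroup F] [InnerProductSpace ℝ F] [NormedAddCommGroup E']
    [InnerProductSpace ℝ E'] : (E →L[ℝ] E') →L[ℝ] (HTensor F E →L[ℝ] HTensor E' F) :=
  LinearMap.mkContinuous
    { toFun := fun A => ContinuousLinearMap.completion
        ((TensorProduct.commIsometry ℝ F E').toContinuousLinearEquiv.toContinuousLinearMap.comp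
          (A.lTensor F))
      map_add' := fun B C => HTensor.clm_ext fun a b => by
        simp [htmul, UniformSpace.Completion.coe_add]
      map_smul' := fun r B => HTensor.clm_ext fun a b => by
        simp [htmul, UniformSpace.Completion.coe_smul] }
    1 (fun A => by
      rw [one_mul]
      refine (norm_completion_le _).trans ?_
      refine (ContinuousLinearMap.opNorm_le_bound _ (norm_nonneg (A.lTensor F)) fun x => ?_).trans
        (ContinuousLinearMap.norm_lTensor_le F A)
      simpa using (A.lTensor F).le_opNorm x)

theorem htSwapL_htmul (A : E →L[ℝ] E') (c : F) (a : E) :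
    htSwapL E F E' A (htmul c a) = htmul (A a) c := by
  simp [htSwapL, htmul]

end HilbertTensorMaps

/-! ### Elementary tensors in tensor powers. -/

section TensorPower

variable {G : Type u} [NormedAddCommGroup G] [InnerProductSpace ℝ G] [CompleteSpace G]

theorem elemTensor_succ (n : ℕ) (f : Fin (n + 2) → G) :
    elemTensor (n + 1) f = htmul (f 0) (elemTensor n (Fin.tail f)) := rfl

theorem inner_elemTensor (n : ℕ) (f f' : Fin (n + 1) → G) :
    ⟪elemTensor n f, elemTensor n f'⟫_ℝ = ∏ k, ⟪f k, f' k⟫_ℝ := by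
  induction n with
  | zero => simp; rfl
  | succ n ih =>
    rw [elemTensor_succ, elemTensor_succ, Fin.prod_univ_succ]
    exact (inner_htmul_htmul _ _ _ _).trans (congrArg _ (ih _ _))

theorem norm_elemTensor (n : ℕ) (f : Fin (n + 1) → G) : ‖elemTensor n f‖ = ∏ k, ‖f k‖ := by
  induction n with
  | zero => simp; rfl
  | succ n ih =>
    rw [elemTensor_succ, Fin.prod_univ_succ]
    exact (norm_htmul _ _).trans (congrArg _ (ih _))

theorem continuous_elemTensor (n : ℕ) :
    Continuous (elemTensor n : (Fin (n + 1) → G) → TensorPow G n) := by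
  induction n with
  | zero => exact continuous_apply 0
  | succ n ih =>
    have h : Continuous fun f : Fin (n + 2) → G =>
        htmulL G (TensorPow G n) (f 0) (elemTensor n (Fin.tail f)) :=
      ((htmulL G (TensorPow G n)).continuous.comp (continuous_apply 0)).clm_apply
        (ih.comp (by unfold Fin.tail; fun_prop))
    exact h

/-- Bounded operators on a tensor power are determined by their values on elementary tensors. -/
theorem TensorPow.clm_ext {X : Type*} [NormedAddCommGroup X] [NormedSpace ℝ X] (n : ℕ)
    {A B : TensorPow G n →L[ℝ] X} (h : ∀ f, A (elemTensor n f) = B (elemTensor n f)) : A = B := by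
  induction n with
  | zero =>
    ext x
    exact h fun _ => x
  | succ n ih =>
    change HTensor G (TensorPow G n) →L[ℝ] X at A B
    refine HTensor.clm_ext fun a b => ?_
    have := ih (A := A.comp (htmulL G (TensorPow G n) a)) (B := B.comp (htmulL G (TensorPow G n) a))
      fun f => by
        simpa [elemTensor_succ] using! h (Fin.cons a f)
    exact DFunLike.congr_fun this b

theorem TensorPow.ext_inner (n : ℕ) {x y : TensorPow G n}
    (h : ∀ f, ⟪x, elemTensor n f⟫_ℝ = ⟪y, elemTensor n f⟫_ℝ) : x = y := by
  have : innerSL ℝ x = innerSL ℝ y := TensorPow.clm_ext n h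
  exact ext_inner_right ℝ fun z => DFunLike.congr_fun this z

/-- The bounded linear map `y ↦ f 0 ⊗ ⋯ ⊗ f (n - 1) ⊗ y`. -/
def elemTensorSnocL : (n : ℕ) → (Fin n → G) → G →L[ℝ] TensorPow G n
  | 0, _ => ContinuousLinearMap.id ℝ G
  | n + 1, f => (htmulL G (TensorPow G n) (f 0)).comp (elemTensorSnocL n (Fin.tail f))

theorem elemTensorSnocL_apply (n : ℕ) (f : Fin n → G) (y : G) :
    elemTensorSnocL n f y = elemTensor n (Fin.snoc (α := fun _ => G) f y) := by
  induction n with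
  | zero => rfl
  | succ n ih =>
    induction f using Fin.consCases with
    | _ c f =>
    rw [elemTensor_succ, ← Fin.cons_snoc_eq_snoc_cons]
    exact congrArg (htmul c) (ih f)

/-- The right side is visibly continuous and linear in `x`, which the later reductions to elementary
tensors need. -/
theorem tensorOp_adjoint_apply (x : HTensor G G) (c : G) :
    (tensorOp x).adjoint c = (htmulL G G c).adjoint x := by
  refine ext_inner_right ℝ fun d => ?_
  rw [ContinuousLinearMap.adjoint_inner_left, ContinuousLinearMap.adjoint_inner_left,
    tensorOp_apply, ContinuousLinearMap.adjoint_inner_right, tensorRight_apply, htmulL_apply,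
    real_inner_comm]

theorem tensorOp_htmul_adjoint_apply (a b c : G) :
    (tensorOp (htmul a b)).adjoint c = ⟪c, a⟫_ℝ • b := by
  refine ext_inner_right ℝ fun d => ?_
  rw [ContinuousLinearMap.adjoint_inner_left, tensorOp_htmul, inner_smul_right, inner_smul_left]
  simp [mul_comm]

end TensorPower

/-! ### The operator appending one core. -/

section Append

variable {S : Type v} {G : Type u} [NormedAddCommGroup G] [InnerProductSpace ℝ G]
  [CompleteSpace G] [RKHS ℝ G S ℝ]

/-- The adjoint of multiplication as a bounded bilinear map. -/
def FormsAlgebra.mulAdjointL (hG : FormsAlgebra G) : G →L[ℝ] G →L[ℝ] G :=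
  LinearMap.mkContinuous₂
    (LinearMap.mk₂ ℝ hG.mulAdjoint
      (fun f f' g => by simp [mulAdjoint])
      (fun c f g => by simp [mulAdjoint])
      (fun f g g' => by simp [mulAdjoint])
      (fun c f g => by simp [mulAdjoint]))
    ‖hG.mulL.flip‖
    (fun f g => by
      change ‖(hG.mulL.flip g).adjoint f‖ ≤ _
      refine ((hG.mulL.flip g).adjoint.le_opNorm f).trans ?_
      rw [LinearIsometryEquiv.norm_map, mul_right_comm]
      exact mul_le_mul_of_nonneg_right (hG.mulL.flip.le_opNorm g) (norm_nonneg _))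

theorem FormsAlgebra.mulAdjointL_apply (hG : FormsAlgebra G) (f g : G) :
    hG.mulAdjointL f g = hG.mulAdjoint f g := rfl

/-- The operator on tensor powers which, for a tensor `h ⊗ g`, replaces the last factor `f` by
`[T f] g` and appends the factor `h`. -/
def FormsAlgebra.appendL (hG : FormsAlgebra G) :
    (n : ℕ) → HTensor G G →L[ℝ] (TensorPow G n →L[ℝ] TensorPow G (n + 1))
  -- `T a` acts on one leg only, so this is bounded even if multiplication does not extend boundedly
  -- to `HTensor G G`.
  | 0 => ((htSwapL G G G).comp hG.mulAdjointL).flip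
  | n + 1 => (htLeftL G (TensorPow G n) (TensorPow G (n + 1))).comp (hG.appendL n)

theorem FormsAlgebra.appendL_htmul_elemTensor (hG : FormsAlgebra G) (n : ℕ) (h g : G)
    (f : Fin n → G) (a : G) :
    hG.appendL n (htmul h g) (elemTensor n (Fin.snoc (α := fun _ => G) f a)) =
      elemTensor (n + 1) (Fin.snoc (α := fun _ => G)
        (Fin.snoc (α := fun _ => G) f (hG.mulAdjoint a g)) h) := by
  induction n with
  | zero => exact htSwapL_htmul _ _ _
  | succ n ih =>
    induction f using Fin.consCases with
    | _ c f =>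
    rw [elemTensor_succ, elemTensor_succ, ← Fin.cons_snoc_eq_snoc_cons, ← Fin.cons_snoc_eq_snoc_cons,
      ← Fin.cons_snoc_eq_snoc_cons]
    simp only [Fin.cons_zero, Fin.tail_cons]
    refine (htLeftL_htmul _ _ _).trans ?_
    exact congrArg (htmul c) (ih f)

/-- By density `u` may be taken elementary; then `T` moves to the test vector as multiplication by
`g`. -/
theorem FormsAlgebra.inner_appendL_htmul_elemTensor (hG : FormsAlgebra G) (n : ℕ) (h g : G)
    (u : TensorPow G n) (f : Fin n → G) (a c : G) :
    ⟪hG.appendL n (htmul h g) u, elemTensor (n + 1) (Fin.snoc (α := fun _ => G)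
        (Fin.snoc (α := fun _ => G) f a) c)⟫_ℝ =
      ⟪u, elemTensor n (Fin.snoc (α := fun _ => G) f (hG.mulL a g))⟫_ℝ * ⟪h, c⟫_ℝ := by
  have : (innerSL ℝ (elemTensor (n + 1) (Fin.snoc (α := fun _ => G)
        (Fin.snoc (α := fun _ => G) f a) c))).comp (hG.appendL n (htmul h g)) =
      ⟪h, c⟫_ℝ • innerSL ℝ (elemTensor n (Fin.snoc (α := fun _ => G) f (hG.mulL a g))) := by
    refine TensorPow.clm_ext n fun f' => ?_
    induction f' using Fin.snocCases with
    | _ f' a' =>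
    simp only [ContinuousLinearMap.comp_apply, hG.appendL_htmul_elemTensor,
      smul_apply, innerSL_apply_apply, inner_elemTensor, Fin.prod_univ_castSucc,
      Fin.snoc_castSucc, Fin.snoc_last, smul_eq_mul]
    rw [real_inner_comm (hG.mulAdjoint a' g), hG.inner_mulAdjoint, real_inner_comm h,
      real_inner_comm a']
    ring
  have := DFunLike.congr_fun this u
  simp only [ContinuousLinearMap.comp_apply, smul_apply, innerSL_apply_apply,
    smul_eq_mul] at this
  rw [real_inner_comm, this, mul_comm, real_inner_comm u]

/-- The rank-one case extends by density in `x`, because the adjoint of `h ⊗ g` sends `c` to `⟪c, h⟫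
g`. -/
theorem FormsAlgebra.inner_appendL_elemTensor (hG : FormsAlgebra G) (n : ℕ) (x : HTensor G G)
    (u : TensorPow G n) (f : Fin n → G) (a c : G) :
    ⟪hG.appendL n x u, elemTensor (n + 1) (Fin.snoc (α := fun _ => G)
        (Fin.snoc (α := fun _ => G) f a) c)⟫_ℝ =
      ⟪u, elemTensor n (Fin.snoc (α := fun _ => G) f (hG.mulL a ((tensorOp x).adjoint c)))⟫_ℝ := by
  have : (innerSL ℝ (elemTensor (n + 1) (Fin.snoc (α := fun _ => G)
        (Fin.snoc (α := fun _ => G) f a) c))).comp ((hG.appendL n).flip u) =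
      (innerSL ℝ u).comp
        ((elemTensorSnocL n f).comp ((hG.mulL a).comp (htmulL G G c).adjoint)) := by
    refine HTensor.clm_ext fun h g => ?_
    simp only [ContinuousLinearMap.comp_apply, innerSL_apply_apply, ContinuousLinearMap.flip_apply]
    rw [real_inner_comm, hG.inner_appendL_htmul_elemTensor, ← tensorOp_adjoint_apply,
      tensorOp_htmul_adjoint_apply, map_smul, map_smul, inner_smul_right, real_inner_comm c, mul_comm,
      elemTensorSnocL_apply]
  have := DFunLike.congr_fun this x
  simp only [ContinuousLinearMap.comp_apply, innerSL_apply_apply,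
    ContinuousLinearMap.flip_apply] at this
  rw [real_inner_comm, this, elemTensorSnocL_apply, tensorOp_adjoint_apply]

/-- The appended last factors are `h` and `h'`, so every pairing contains the factor `⟪h, h'⟫`. -/
theorem FormsAlgebra.inner_appendL_of_orthogonal (hG : FormsAlgebra G) (n : ℕ) {h h' : G}
    (hh : ⟪h, h'⟫_ℝ = 0) (g g' : G) (u u' : TensorPow G n) :
    ⟪hG.appendL n (htmul h g) u, hG.appendL n (htmul h' g') u'⟫_ℝ = 0 := by
  have : (innerSL ℝ (hG.appendL n (htmul h g) u)).comp (hG.appendL n (htmul h' g')) = 0 := by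
    refine TensorPow.clm_ext n fun f => ?_
    induction f using Fin.snocCases with
    | _ f a =>
    simp [hG.appendL_htmul_elemTensor, hG.inner_appendL_htmul_elemTensor, hh]
  exact DFunLike.congr_fun this u'

end Append

/-! ### Unconditional summability from orthogonality. -/

section Summability

variable {H H₀ ι : Type*} [NormedAddCommGroup H] [InnerProductSpace ℝ H]
  [NormedAddCommGroup H₀] [InnerProductSpace ℝ H₀]

theorem norm_sum_sq_of_orthogonal (v : ℕ → H) (s : Finset ℕ)
    (hv : Pairwise fun i j => ⟪v i, v j⟫_ℝ = 0) :
    ‖∑ i ∈ s, v i‖ ^ 2 = ∑ i ∈ s, ‖v i‖ ^ 2 := by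
  rw [← real_inner_self_eq_norm_sq, sum_inner]
  refine Finset.sum_congr rfl fun i hi => ?_
  rw [inner_sum, Finset.sum_eq_single_of_mem i hi fun j _ hj => hv hj.symm,
    real_inner_self_eq_norm_sq]

theorem summable_norm_sq_of_orthogonal {v : ℕ → H} {x : H}
    (hv : Pairwise fun i j => ⟪v i, v j⟫_ℝ = 0)
    (hx : Tendsto (fun r => ∑ i ∈ Finset.range r, v i) atTop (𝓝 x)) :
    Summable fun i => ‖v i‖ ^ 2 := by
  have h : Tendsto (fun r => ∑ i ∈ Finset.range r, ‖v i‖ ^ 2) atTop (𝓝 (‖x‖ ^ 2)) := by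
    simpa only [norm_sum_sq_of_orthogonal v _ hv] using hx.norm.pow 2
  exact ((hasSum_iff_tendsto_nat_of_nonneg (fun i => by positivity) _).2 h).summable

/-- The Cauchy criterion with tolerance 1 bounds the part of `t` outside a fixed finite set; the
part inside is bounded by the sum of norms. -/
theorem exists_norm_sum_le_of_summable [CompleteSpace H₀] {y : ι → H₀} (hy : Summable y) :
    ∃ D > 0, ∀ t : Finset ι, ‖∑ i ∈ t, y i‖ ≤ D := by
  classical
  obtain ⟨s, hs⟩ := summable_iff_vanishing_norm.1 hy 1 one_pos
  refine ⟨1 + ∑ i ∈ s, ‖y i‖, by positivity, fun t => ?_⟩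
  rw [← Finset.sum_inter_add_sum_sdiff t s, add_comm]
  refine (norm_add_le _ _).trans (add_le_add (hs _ Finset.sdiff_disjoint).le ?_)
  exact (norm_sum_le _ _).trans
    (Finset.sum_le_sum_of_subset_of_nonneg Finset.inter_subset_right fun _ _ _ => norm_nonneg _)

/-- A doubly indexed family built from a summable family by operators with orthogonal ranges and
square summable norms is summable. -/
theorem summable_of_orthogonal_operators [CompleteSpace H] [CompleteSpace H₀]
    {y : ι → H₀} (hy : Summable y)
    {A : ℕ → H₀ →L[ℝ] H} (hA : Pairwise fun i j => ∀ u v, ⟪A i u, A j v⟫_ℝ = 0)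
    (hs : Summable fun j => ‖A j‖ ^ 2) :
    Summable fun p : ι × ℕ => A p.2 (y p.1) := by
  classical
  -- Group by the second index and apply Pythagoras.
  have key : ∀ F : Finset (ι × ℕ), ‖∑ p ∈ F, A p.2 (y p.1)‖ ^ 2 =
      ∑ j ∈ F.image Prod.snd, ‖A j (∑ i ∈ (F.filter fun p => p.2 = j).image Prod.fst, y i)‖ ^ 2 := by
    intro F
    rw [← norm_sum_sq_of_orthogonal _ _ fun i j hij => hA hij _ _,
      ← Finset.sum_fiberwise_of_maps_to (g := Prod.snd) (t := F.image Prod.snd)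
        fun p hp => Finset.mem_image_of_mem _ hp]
    congr 2
    refine Finset.sum_congr rfl fun j _ => ?_
    rw [Finset.sum_image, map_sum]
    · refine Finset.sum_congr rfl fun p hp => ?_
      rw [(Finset.mem_filter.1 hp).2]
    · intro p hp q hq hpq
      simp only [Finset.coe_filter, Set.mem_ofPred_eq] at hp hq
      exact Prod.ext hpq (hp.2.trans hq.2.symm)
  obtain ⟨D, hD0, hD⟩ := exists_norm_sum_le_of_summable hy
  rw [summable_iff_vanishing_norm]
  intro ε hε
  -- The extra 1 makes `K` positive and the bound on the partial sums strict.
  set K := ∑' j, ‖A j‖ ^ 2 + 1 with hK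
  have hK0 : 0 < K := by positivity
  obtain ⟨J, hJ⟩ := summable_iff_vanishing_norm.1 hs (ε ^ 2 / (2 * D ^ 2)) (by positivity)
  obtain ⟨s, hs'⟩ := summable_iff_vanishing_norm.1 hy (ε / Real.sqrt (2 * K)) (by positivity)
  refine ⟨s ×ˢ J, fun F hF => ?_⟩
  refine lt_of_pow_lt_pow_left₀ 2 hε.le ?_
  rw [key, ← Finset.sum_filter_add_sum_filter_not _ (fun j => j ∈ J)]
  -- For `j ∈ J` the fibre of `F` over `j` misses `s`, so its sum of `y i` is small.
  have h1 : ∑ j ∈ (F.image Prod.snd).filter (fun j => j ∈ J),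
      ‖A j (∑ i ∈ (F.filter fun p => p.2 = j).image Prod.fst, y i)‖ ^ 2 < ε ^ 2 / 2 := by
    have hle : ∀ j ∈ (F.image Prod.snd).filter (fun j => j ∈ J),
        ‖A j (∑ i ∈ (F.filter fun p => p.2 = j).image Prod.fst, y i)‖ ^ 2 ≤
          ‖A j‖ ^ 2 * (ε ^ 2 / (2 * K)) := by
      intro j hj
      have hjJ := (Finset.mem_filter.1 hj).2
      have hlt := hs' ((F.filter fun p => p.2 = j).image Prod.fst) (by
        rw [Finset.disjoint_left]
        intro i hi his
        obtain ⟨p, hp, rfl⟩ := Finset.mem_image.1 hi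
        rw [Finset.mem_filter] at hp
        exact Finset.disjoint_left.1 hF hp.1 (Finset.mem_product.2 ⟨his, hp.2 ▸ hjJ⟩))
      calc _ ≤ (‖A j‖ * (ε / Real.sqrt (2 * K))) ^ 2 := by
            gcongr
            exact (A j).le_opNorm_of_le hlt.le
        _ = _ := by rw [mul_pow, div_pow, Real.sq_sqrt (by positivity)]
    calc _ ≤ _ := Finset.sum_le_sum hle
      _ = (∑ j ∈ (F.image Prod.snd).filter (fun j => j ∈ J), ‖A j‖ ^ 2) * (ε ^ 2 / (2 * K)) := by
          rw [Finset.sum_mul]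
      _ < K * (ε ^ 2 / (2 * K)) := by
          gcongr
          exact lt_of_le_of_lt (hs.sum_le_tsum _ fun _ _ => by positivity) (lt_add_one _)
      _ = ε ^ 2 / 2 := by field_simp
  -- For `j ∉ J` the fibre sums are only bounded by `D`, but the tail of `‖A j‖ ^ 2` is small.
  have h2 : ∑ j ∈ (F.image Prod.snd).filter (fun j => j ∉ J),
      ‖A j (∑ i ∈ (F.filter fun p => p.2 = j).image Prod.fst, y i)‖ ^ 2 ≤ ε ^ 2 / 2 := by
    have hlt := hJ ((F.image Prod.snd).filter (fun j => j ∉ J)) (by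
      rw [Finset.disjoint_left]
      intro j hj
      exact (Finset.mem_filter.1 hj).2)
    calc _ ≤ ∑ j ∈ (F.image Prod.snd).filter (fun j => j ∉ J), ‖A j‖ ^ 2 * D ^ 2 := by
          refine Finset.sum_le_sum fun j _ => ?_
          rw [← mul_pow]
          gcongr
          exact (A j).le_opNorm_of_le (hD _)
      _ = (∑ j ∈ (F.image Prod.snd).filter (fun j => j ∉ J), ‖A j‖ ^ 2) * D ^ 2 := by
          rw [Finset.sum_mul]
      _ ≤ (ε ^ 2 / (2 * D ^ 2)) * D ^ 2 := by
          gcongr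
          exact (le_abs_self _).trans hlt.le
      _ = ε ^ 2 / 2 := by field_simp
  linarith

end Summability

/-! ### Boxes of multi-indices. -/

section Boxes

theorem tendsto_init_atTop (n : ℕ) :
    Tendsto (fun R : Fin (n + 1) → ℕ => (Fin.init R : Fin n → ℕ)) atTop atTop := by
  refine tendsto_atTop.2 fun b => ?_
  filter_upwards [eventually_ge_atTop (Fin.snoc (α := fun _ => ℕ) b 0)] with R hR k
  simpa [Fin.init] using hR k.castSucc

theorem tendsto_apply_atTop {n : ℕ} (k : Fin n) :
    Tendsto (fun R : Fin n → ℕ => R k) atTop atTop := by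
  refine tendsto_atTop.2 fun b => ?_
  filter_upwards [eventually_ge_atTop (fun _ => b)] with R hR using hR k

theorem tendsto_piFinset_range_atTop (n : ℕ) :
    Tendsto (fun R : Fin n → ℕ => Fintype.piFinset fun k => Finset.range (R k)) atTop atTop := by
  refine tendsto_atTop_finset_of_monotone (fun R R' h => ?_) fun i => ⟨fun k => i k + 1, by simp⟩
  exact Fintype.piFinset_subset _ _ fun k => Finset.range_mono (h k)

theorem sum_piFinset_range_succ {M : Type*} [AddCommMonoid M] (n : ℕ) (R : Fin (n + 1) → ℕ)
    (f : (Fin (n + 1) → ℕ) → M) :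
    ∑ i ∈ Fintype.piFinset fun k => Finset.range (R k), f i =
      ∑ i ∈ Fintype.piFinset fun k => Finset.range (Fin.init R k),
        ∑ j ∈ Finset.range (R (Fin.last n)), f (Fin.snoc (α := fun _ => ℕ) i j) := by
  rw [← Finset.sum_product']
  refine Finset.sum_nbij' (fun i => (Fin.init i, i (Fin.last n)))
    (fun p => Fin.snoc (α := fun _ => ℕ) p.1 p.2) ?_ ?_ ?_ ?_ ?_
  · intro i hi
    simp only [Fintype.mem_piFinset, Finset.mem_product, Finset.mem_range] at hi ⊢
    exact ⟨fun k => hi k.castSucc, hi _⟩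
  · intro p hp
    simp only [Fintype.mem_piFinset, Finset.mem_product, Finset.mem_range] at hp ⊢
    refine Fin.lastCases ?_ fun k => ?_
    · simpa using hp.2
    · simpa [Fin.init] using hp.1 k
  · simp
  · simp
  · simp

end Boxes

/-! ### Summands of the tensor train. -/

section Train

variable {S : Type v} {G : Type u} [NormedAddCommGroup G] [InnerProductSpace ℝ G]
  [CompleteSpace G] [RKHS ℝ G S ℝ]

/-- A summand of the tensor train started at `m`, built by appending one factor at a time. -/
def FormsAlgebra.trainTerm (hG : FormsAlgebra G) (x : ℕ → HTensor G G) (m : G) :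
    (n : ℕ) → (Fin n → ℕ) → TensorPow G n
  | 0, _ => m
  | n + 1, i => hG.appendL n (x (i (Fin.last n))) (hG.trainTerm x m n (Fin.init i))

/-- Each step turns the last factor `lam i • h i` left by its predecessor into `[T (lam i • h i)] g
j = lam i • w i j`; the first step turns `m` into `b`. -/
theorem FormsAlgebra.trainTerm_eq_elemTensor (hG : FormsAlgebra G) (lam : ℕ → ℝ) (h g : ℕ → G)
    (m : G) (N : ℕ) (i : Fin (N + 1) → ℕ) :
    hG.trainTerm (fun j => lam j • htmul (h j) (g j)) m (N + 1) i =
      elemTensor (N + 1) (trainFactors lam (fun j => hG.mulAdjoint m (g j))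
        (fun j k => hG.mulAdjoint (h j) (g k)) h i) := by
  have key : ∀ (n : ℕ) (f : Fin n → G) (a : G) (j : ℕ),
      hG.appendL n (lam j • htmul (h j) (g j)) (elemTensor n (Fin.snoc (α := fun _ => G) f a)) =
        elemTensor (n + 1) (Fin.snoc (α := fun _ => G)
          (Fin.snoc (α := fun _ => G) f (hG.mulAdjoint a (g j))) (lam j • h j)) := by
    intro n f a j
    -- Linearity of `elemTensorSnocL` absorbs the scalar into the last factor.
    rw [map_smul, smul_apply, hG.appendL_htmul_elemTensor, ← elemTensorSnocL_apply,
      ← elemTensorSnocL_apply, map_smul]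
  induction N with
  | zero =>
    refine (key 0 Fin.elim0 m (i 0)).trans ?_
    congr 1
    funext k
    fin_cases k <;> rfl
  | succ N ih =>
    rw [trainTerm, ih, trainFactors, Fin.cons_snoc_eq_snoc_cons, key, trainFactors,
      Fin.cons_snoc_eq_snoc_cons]
    congr 2
    have : hG.mulAdjoint (lam (Fin.init i (Fin.last N)) • h (Fin.init i (Fin.last N)))
        (g (i (Fin.last (N + 1)))) = lam (i (Fin.last N).castSucc) •
          hG.mulAdjoint (h (i (Fin.last N).castSucc)) (g (i (Fin.last N).succ)) := by
      simp only [← hG.mulAdjointL_apply, map_smul, smul_apply, Fin.init, Fin.succ_last]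
    rw [this, ← Fin.cons_snoc_eq_snoc_cons]
    congr 1
    funext k
    refine Fin.lastCases ?_ (fun k => ?_) k
    · simp
    · simp [Fin.init]

theorem FormsAlgebra.sum_trainTerm_succ (hG : FormsAlgebra G) (x : ℕ → HTensor G G) (m : G)
    (n : ℕ) (R : Fin (n + 1) → ℕ) :
    ∑ i ∈ Fintype.piFinset fun k => Finset.range (R k), hG.trainTerm x m (n + 1) i =
      hG.appendL n (∑ j ∈ Finset.range (R (Fin.last n)), x j)
        (∑ i ∈ Fintype.piFinset fun k => Finset.range (Fin.init R k), hG.trainTerm x m n i) := by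
  rw [sum_piFinset_range_succ, map_sum]
  refine Finset.sum_congr rfl fun i _ => ?_
  rw [map_sum, sum_apply]
  simp [trainTerm]

theorem FormsAlgebra.summable_trainTerm (hG : FormsAlgebra G) {lam : ℕ → ℝ} {h g : ℕ → G}
    (hh : Pairwise fun i j => ⟪h i, h j⟫_ℝ = 0)
    (hs : Summable fun j => ‖lam j • htmul (h j) (g j)‖ ^ 2) (m : G) (n : ℕ) :
    Summable (hG.trainTerm (fun j => lam j • htmul (h j) (g j)) m n) := by
  induction n with
  | zero => exact Summable.of_finite
  | succ n ih =>
    have hA : Summable fun j => ‖hG.appendL n (lam j • htmul (h j) (g j))‖ ^ 2 := by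
      refine Summable.of_nonneg_of_le (fun _ => by positivity) (fun j => ?_)
        (hs.mul_left (‖hG.appendL n‖ ^ 2))
      rw [← mul_pow]
      exact pow_le_pow_left₀ (norm_nonneg _) ((hG.appendL n).le_opNorm _) 2
    have horth : Pairwise fun i j => ∀ u v, ⟪hG.appendL n (lam i • htmul (h i) (g i)) u,
        hG.appendL n (lam j • htmul (h j) (g j)) v⟫_ℝ = 0 := by
      intro i j hij u v
      rw [map_smul, map_smul, smul_apply, smul_apply, real_inner_smul_left, real_inner_smul_right,
        hG.inner_appendL_of_orthogonal n (hh hij), mul_zero, mul_zero]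
    have := summable_of_orthogonal_operators ih
      (A := fun j => hG.appendL n (lam j • htmul (h j) (g j))) horth hA
    have he : Function.Injective fun i : Fin (n + 1) → ℕ =>
        ((Fin.init i, i (Fin.last n)) : (Fin n → ℕ) × ℕ) := by
      intro i j hij
      rw [Prod.mk.injEq] at hij
      rw [← Fin.snoc_init_self i, ← Fin.snoc_init_self j, hij.1, hij.2]
    have hterm : hG.trainTerm (fun j => lam j • htmul (h j) (g j)) m (n + 1) =
        (fun p : (Fin n → ℕ) × ℕ => hG.appendL n (lam p.2 • htmul (h p.2) (g p.2))
          (hG.trainTerm (fun j => lam j • htmul (h j) (g j)) m n p.1)) ∘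
        fun i : Fin (n + 1) → ℕ => (Fin.init i, i (Fin.last n)) := by
      funext i
      rw [trainTerm, Function.comp_apply]
    rw [hterm]
    exact this.comp_injective he

end Train

/-! ### Bounded features and integrability. -/

section FeatureBounds

variable {S : Type v} {G : Type u} [NormedAddCommGroup G] [InnerProductSpace ℝ G]
  [CompleteSpace G] [RKHS ℝ G S ℝ]

/-- The feature map of a reproducing kernel Hilbert algebra is bounded. -/
theorem FormsAlgebra.norm_feature_le (hG : FormsAlgebra G) (z : S) :
    ‖feature G z‖ ≤ ‖hG.mulL‖ := by
  rcases (norm_nonneg (feature G z)).eq_or_lt with h0 | h0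
  · rw [← h0]; positivity
  -- The square of the feature, evaluated at `z`, is `‖feature G z‖ ^ 4`, while boundedness of
  -- multiplication caps it by `‖hG.mulL‖ * ‖feature G z‖ ^ 3`.
  have h1 : ⟪feature G z, hG.mulL (feature G z) (feature G z)⟫_ℝ = ‖feature G z‖ ^ 4 := by
    rw [inner_feature, hG.mulL_apply, ← inner_feature, real_inner_self_eq_norm_sq]
    ring
  have h2 := (real_inner_le_norm (feature G z) (hG.mulL (feature G z) (feature G z))).trans
    (mul_le_mul_of_nonneg_left (hG.mulL.le_opNorm₂ _ _) h0.le)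
  rw [h1] at h2
  refine le_of_mul_le_mul_right ?_ (pow_pos h0 3)
  calc ‖feature G z‖ * ‖feature G z‖ ^ 3 = ‖feature G z‖ ^ 4 := by ring
    _ ≤ _ := h2
    _ = _ := by ring

theorem FormsAlgebra.abs_apply_le (hG : FormsAlgebra G) (f : G) (z : S) :
    ‖f z‖ ≤ ‖hG.mulL‖ * ‖f‖ := by
  rw [← inner_feature, Real.norm_eq_abs]
  exact (abs_real_inner_le_norm _ _).trans
    (mul_le_mul_of_nonneg_right (hG.norm_feature_le z) (norm_nonneg _))

variable [MeasurableSpace S] [MeasurableSpace G] [BorelSpace G]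
  [TopologicalSpace.SeparableSpace G]

theorem measurable_coe_of_measurable_feature (hmeas : Measurable (feature G : S → G)) (f : G) :
    Measurable fun z => f z := by
  have : Measurable fun z => innerSL ℝ f (feature G z) :=
    (innerSL ℝ f).continuous.measurable.comp hmeas
  convert this using 2 with z
  rw [innerSL_apply_apply, real_inner_comm, inner_feature]

variable {Ω : Type w} [MeasurableSpace Ω] {P : Measure Ω} [IsProbabilityMeasure P]

theorem FormsAlgebra.integrable_elemTensor_feature (hG : FormsAlgebra G)
    (hmeas : Measurable (feature G : S → G)) {n : ℕ} {Z : Fin (n + 1) → Ω → S}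
    (hZ : ∀ k, AEMeasurable (Z k) P) :
    Integrable (fun ω => elemTensor n fun k => feature G (Z k ω)) P := by
  have : SecondCountableTopology G := UniformSpace.secondCountable_of_separable G
  refine Integrable.of_bound (C := ∏ _k : Fin (n + 1), ‖hG.mulL‖) ?_ (.of_forall fun ω => ?_)
  · refine (continuous_elemTensor n).comp_aestronglyMeasurable ?_
    refine AEMeasurable.aestronglyMeasurable ?_
    exact aemeasurable_pi_lambda _ fun k => hmeas.comp_aemeasurable (hZ k)
  · rw [norm_elemTensor]
    exact Finset.prod_le_prod (fun _ _ => norm_nonneg _) fun _ _ => hG.norm_feature_le _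

theorem FormsAlgebra.integrable_feature (hG : FormsAlgebra G)
    (hmeas : Measurable (feature G : S → G)) {ν : Measure S} [IsProbabilityMeasure ν] :
    Integrable (feature G : S → G) ν := by
  have : SecondCountableTopology G := UniformSpace.secondCountable_of_separable G
  exact Integrable.of_bound hmeas.aestronglyMeasurable ‖hG.mulL‖ (.of_forall hG.norm_feature_le)

/-- A conditional mean embedding operator computes conditional expectations. -/
theorem FormsAlgebra.integral_eq_adjoint_apply (hG : FormsAlgebra G)
    (hmeas : Measurable (feature G : S → G)) {κ : Kernel S S} [IsMarkovKernel κ] {U : G →L[ℝ] G}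
    (hU : ∀ z : S, U (feature G z) = ∫ z', feature G z' ∂(κ z)) (f : G) (z : S) :
    ∫ z', f z' ∂(κ z) = U.adjoint f z := by
  rw [← inner_feature, ContinuousLinearMap.adjoint_inner_right, hU, real_inner_comm,
    ← integral_inner (hG.integrable_feature hmeas)]
  exact integral_congr_ae (.of_forall fun z' => by
    simp only [real_inner_comm (feature G z'), inner_feature])

end FeatureBounds

/-! ### The Markov property in tensor form. -/

section MarkovChains

/-- The joint law of `(V, W)` is `(P.map V) ⊗ₘ η`; Fubini integrates out `W` first, the bounds
supplying integrability. -/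
theorem integral_mul_of_hasCondDistrib {X Y Ω : Type*} [MeasurableSpace X] [MeasurableSpace Y]
    [MeasurableSpace Ω] {P : Measure Ω} [IsFiniteMeasure P] {η : Kernel X Y} [IsMarkovKernel η]
    {V : Ω → X} {W : Ω → Y} (h : HasCondDistrib W V η P) {p : X → ℝ} {q : Y → ℝ}
    (hp : Measurable p) (hq : Measurable q) {C D : ℝ} (hC : ∀ x, ‖p x‖ ≤ C)
    (hD : ∀ y, ‖q y‖ ≤ D) :
    ∫ ω, p (V ω) * q (W ω) ∂P = ∫ ω, p (V ω) * ∫ y, q y ∂(η (V ω)) ∂P := by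
  have hm : Measurable fun a : X × Y => p a.1 * q a.2 := by fun_prop
  have hint : Integrable (fun a : X × Y => p a.1 * q a.2) ((P.map V) ⊗ₘ η) :=
    Integrable.of_bound hm.aestronglyMeasurable (C * D) (.of_forall fun a => by
      rw [norm_mul]
      exact mul_le_mul (hC _) (hD _) (norm_nonneg _) ((norm_nonneg _).trans (hC a.1)))
  have h1 := h.integral_comp (f := fun a : X × Y => p a.1 * q a.2) hm.aestronglyMeasurable
  have h2 : StronglyMeasurable fun x => p x * ∫ y, q y ∂(η x) :=
    hp.stronglyMeasurable.mul hq.stronglyMeasurable.integral_kernel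
  refine h1.trans ?_
  rw [Measure.integral_compProd hint]
  simp_rw [integral_const_mul]
  exact integral_map h.aemeasurable_fst h2.aestronglyMeasurable

variable {S : Type v} {Ω : Type w} [MeasurableSpace S] [MeasurableSpace Ω] {P : Measure Ω}
  {κ : Kernel S S}

theorem IsMarkovChain.castSucc {N : ℕ} {Z : Fin (N + 2) → Ω → S} (hZ : IsMarkovChain Z κ P) :
    IsMarkovChain (fun k : Fin (N + 1) => Z k.castSucc) κ P :=
  fun n => hZ n.castSucc

theorem IsMarkovChain.aemeasurable {N : ℕ} {Z : Fin (N + 2) → Ω → S} (hZ : IsMarkovChain Z κ P)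
    (k : Fin (N + 2)) : AEMeasurable (Z k) P := by
  refine Fin.cases ?_ (fun k => (hZ k).aemeasurable_snd) k
  -- `Z 0` is never a target of a transition; it is the whole past of the first one.
  exact (aemeasurable_pi_iff.1 (hZ 0).aemeasurable_fst) 0

variable {G : Type u} [NormedAddCommGroup G] [InnerProductSpace ℝ G]
  [CompleteSpace G] [RKHS ℝ G S ℝ] [MeasurableSpace G] [BorelSpace G]
  [TopologicalSpace.SeparableSpace G] [IsProbabilityMeasure P] [IsMarkovKernel κ]

/-- One more step of a Markov chain appends one core to the mean embedding of the chain. -/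
theorem FormsAlgebra.integral_elemTensor_succ (hG : FormsAlgebra G)
    (hmeas : Measurable (feature G : S → G)) {x : HTensor G G}
    (hU : ∀ z : S, tensorOp x (feature G z) = ∫ z', feature G z' ∂(κ z))
    {n : ℕ} {Z : Fin (n + 2) → Ω → S} (hZ : IsMarkovChain Z κ P) :
    ∫ ω, elemTensor (n + 1) (fun k => feature G (Z k ω)) ∂P =
      hG.appendL n x (∫ ω, elemTensor n (fun k => feature G (Z k.castSucc ω)) ∂P) := by
  refine TensorPow.ext_inner (n + 1) fun f => ?_
  induction f using Fin.snocCases with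
  | _ f c =>
  induction f using Fin.snocCases with
  | _ f a =>
  rw [hG.inner_appendL_elemTensor, real_inner_comm,
    ← integral_inner (hG.integrable_elemTensor_feature hmeas hZ.aemeasurable),
    real_inner_comm, ← integral_inner (hG.integrable_elemTensor_feature hmeas
      fun k => hZ.aemeasurable k.castSucc)]
  simp only [inner_elemTensor, real_inner_comm (feature G _), inner_feature,
    Fin.prod_univ_castSucc, Fin.snoc_castSucc, Fin.snoc_last, hG.mulL_apply]
  have hm := measurable_coe_of_measurable_feature hmeas
  -- The left side is now the mean of a function `p` of the past times `c` at the new state;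
  -- conditioning replaces the latter by `U* c` at the current state.
  have key := integral_mul_of_hasCondDistrib (hZ (Fin.last n))
    (p := fun past => (∏ k : Fin n, f k (past k.castSucc)) * a (past (Fin.last n)))
    (q := fun z => c z)
    ((Finset.measurable_prod _ fun k _ => (hm (f k)).comp (measurable_pi_apply _)).mul
      ((hm a).comp (measurable_pi_apply _))) (hm c)
    (C := (∏ k : Fin n, ‖hG.mulL‖ * ‖f k‖) * (‖hG.mulL‖ * ‖a‖))
    (fun past => by
      rw [norm_mul, norm_prod]
      gcongr
      · exact hG.abs_apply_le _ _
      · exact hG.abs_apply_le _ _)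
    (fun z => hG.abs_apply_le c z)
  refine key.trans (integral_congr_ae (.of_forall fun ω => ?_))
  simp only [Kernel.comap_apply, hG.integral_eq_adjoint_apply hmeas hU, mul_assoc]
  rfl

end MarkovChains

/-! ### Convergence of the box sums. -/

section MeanEmbedding

theorem tendsto_clm_apply {ι X Y : Type*} [NormedAddCommGroup X] [NormedSpace ℝ X]
    [NormedAddCommGroup Y] [NormedSpace ℝ Y] {l : Filter ι} {A : ι → X →L[ℝ] Y} {a : ι → X}
    {A₀ : X →L[ℝ] Y} {a₀ : X} (hA : Tendsto A l (𝓝 A₀)) (ha : Tendsto a l (𝓝 a₀)) :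
    Tendsto (fun i => A i (a i)) l (𝓝 (A₀ a₀)) :=
  (isBoundedBilinearMap_apply.continuous.tendsto (A₀, a₀)).comp (hA.prodMk_nhds ha)

variable {S : Type v} {Ω : Type w} [MeasurableSpace S] [MeasurableSpace Ω] {P : Measure Ω}
  {κ : Kernel S S} {G : Type u} [NormedAddCommGroup G] [InnerProductSpace ℝ G]
  [CompleteSpace G] [RKHS ℝ G S ℝ] [MeasurableSpace G] [BorelSpace G]
  [TopologicalSpace.SeparableSpace G] [IsProbabilityMeasure P] [IsMarkovKernel κ]

/-- The truncated tensor train sums converge to the mean embedding of the chain. -/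
theorem FormsAlgebra.tendsto_sum_trainTerm (hG : FormsAlgebra G)
    (hmeas : Measurable (feature G : S → G)) {x : HTensor G G}
    (hU : ∀ z : S, tensorOp x (feature G z) = ∫ z', feature G z' ∂(κ z)) {y : ℕ → HTensor G G}
    (hy : Tendsto (fun r => ∑ j ∈ Finset.range r, y j) atTop (𝓝 x))
    {n : ℕ} {Z : Fin (n + 1) → Ω → S} (hZ : IsMarkovChain Z κ P) :
    Tendsto (fun R : Fin n → ℕ => ∑ i ∈ Fintype.piFinset fun k => Finset.range (R k),
        hG.trainTerm y (∫ ω, feature G (Z 0 ω) ∂P) n i) atTop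
      (𝓝 (∫ ω, elemTensor n (fun k => feature G (Z k ω)) ∂P)) := by
  induction n with
  | zero =>
    refine tendsto_const_nhds.congr fun R => ?_
    rw [Fintype.piFinset_of_isEmpty, Finset.univ_unique, Finset.sum_singleton]
    rfl
  | succ n ih =>
    simp only [hG.sum_trainTerm_succ]
    rw [hG.integral_elemTensor_succ hmeas hU hZ]
    have h1 : Tendsto (fun R : Fin (n + 1) → ℕ =>
        hG.appendL n (∑ j ∈ Finset.range (R (Fin.last n)), y j)) atTop (𝓝 (hG.appendL n x)) :=
      ((hG.appendL n).continuous.tendsto x).comp (hy.comp (tendsto_apply_atTop (Fin.last n)))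
    have h2 := (ih hZ.castSucc).comp (tendsto_init_atTop n)
    simp only [Function.comp_def, Fin.castSucc_zero] at h2
    exact tendsto_clm_apply h1 h2

end MeanEmbedding

/-! ### Comparison with the Hilbert space adjoint. -/

section HilbertAdjoint

variable {S : Type v} {G : Type u} [NormedAddCommGroup G] [InnerProductSpace ℝ G]
  [CompleteSpace G] [RKHS ℝ G S ℝ]

/-- Paired with `d`, both sides give `⟪f, d · g⟫`, since `Tstar` sends `d ⊗ g` to `d · g`. -/
theorem FormsAlgebra.mulAdjoint_eq_tensorOp_adjoint (hG : FormsAlgebra G)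
    {Tstar : HTensor G G →L[ℝ] G} (hT : ∀ (f k : G) (z : S), Tstar (htmul f k) z = f z * k z)
    (f g : G) : hG.mulAdjoint f g = tensorOp (Tstar.adjoint f) g := by
  refine ext_inner_right ℝ fun d => ?_
  rw [hG.inner_mulAdjoint, tensorOp_apply, ContinuousLinearMap.adjoint_inner_left,
    ContinuousLinearMap.adjoint_inner_left, tensorRight_apply]
  congr 1
  exact RKHS.ext fun z => by rw [hT, hG.mulL_apply]

end HilbertAdjoint

end SpectralMeanFlow

end

open SpectralMeanFlow in
theorem mainTheorem1
    {S : Type*} [MeasurableSpace S]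
    {G : Type*} [NormedAddCommGroup G] [InnerProductSpace ℝ G] [CompleteSpace G]
    [RKHS ℝ G S ℝ]
    [MeasurableSpace G] [BorelSpace G] [TopologicalSpace.SeparableSpace G]
    (hmeas : Measurable (feature G : S → G))
    (hmoment : ∀ π : Measure S, IsProbabilityMeasure π → ∫⁻ z, ‖feature G z‖ₑ ^ 2 ∂π < ⊤)
    (hG : FormsAlgebra G)
    {Ω : Type*} [MeasurableSpace Ω] (P : Measure Ω) [IsProbabilityMeasure P]
    (κ : Kernel S S) [IsMarkovKernel κ]
    (N : ℕ) (Z : Fin (N + 2) → Ω → S) (hZ : IsMarkovChain Z κ P)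
    (U : G →L[ℝ] G) (hU : ∀ z : S, U (feature G z) = ∫ z', feature G z' ∂(κ z))
    (lam : ℕ → ℝ) (h g : ℕ → G) (hdec : IsDecomposition U lam h g)
    (b : ℕ → G) (hb : ∀ i, b i = hG.mulAdjoint (∫ ω, feature G (Z 0 ω) ∂P) (g i))
    (w : ℕ → ℕ → G) (hw : ∀ i j, w i j = hG.mulAdjoint (h i) (g j)) :
    -- the mean embedding of the chain is a genuine Bochner integral
    Integrable (fun ω => elemTensor (N + 1) (fun n => feature G (Z n ω))) P ∧
    -- it is the limit of the tensor train sums truncated at ranks `R 0, …, R N`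
    Tendsto
      (fun R : Fin (N + 1) → ℕ => ∑ i ∈ Fintype.piFinset (fun n => Finset.range (R n)),
        elemTensor (N + 1) (trainFactors lam b w h i))
      atTop (𝓝 (∫ ω, elemTensor (N + 1) (fun n => feature G (Z n ω)) ∂P)) ∧
    -- if the `h i` are orthogonal, as in a singular value decomposition, the sum over all
    -- multi-indices converges unconditionally
    ((Pairwise fun i j => inner ℝ (h i) (h j) = 0) →
      HasSum (fun i : Fin (N + 1) → ℕ => elemTensor (N + 1) (trainFactors lam b w h i))
        (∫ ω, elemTensor (N + 1) (fun n => feature G (Z n ω)) ∂P)) ∧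
    -- if multiplication extends to a bounded operator `G ⊗ G → G`, its Hilbert space adjoint `T`
    -- yields the same `[T f] g` through the identification of tensors with operators
    (∀ Tstar : HTensor G G →L[ℝ] G, (∀ (f k : G) (z : S), Tstar (htmul f k) z = f z * k z) →
      (∀ i, b i = tensorOp (Tstar.adjoint (∫ ω, feature G (Z 0 ω) ∂P)) (g i)) ∧
      (∀ i j, w i j = tensorOp (Tstar.adjoint (h i)) (g j))) := by
  obtain ⟨x, rfl, hx⟩ := hdec
  have hterm : ∀ i : Fin (N + 1) → ℕ, elemTensor (N + 1) (trainFactors lam b w h i) =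
      hG.trainTerm (fun j => lam j • htmul (h j) (g j)) (∫ ω, feature G (Z 0 ω) ∂P) (N + 1) i := by
    intro i
    rw [hG.trainTerm_eq_elemTensor, funext hb, funext fun j => funext (hw j)]
  have hlim := hG.tendsto_sum_trainTerm hmeas hU hx hZ
  simp only [hterm]
  refine ⟨hG.integrable_elemTensor_feature hmeas hZ.aemeasurable, hlim, fun hh => ?_,
    fun Tstar hT => ⟨fun i => ?_, fun i j => ?_⟩⟩
  -- Orthogonality passes to the tensors, so convergence of the series makes their norms square
  -- summable.
  · have horth : Pairwise fun i j =>
        inner ℝ (lam i • htmul (h i) (g i)) (lam j • htmul (h j) (g j)) = 0 := by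
      intro i j hij
      rw [real_inner_smul_left, real_inner_smul_right, inner_htmul, hh hij]
      simp
    have hs := hG.summable_trainTerm hh (summable_norm_sq_of_orthogonal horth hx)
      (∫ ω, feature G (Z 0 ω) ∂P) (N + 1)
    have hsum := hs.hasSum
    -- Box sums are a subnet of the finite partial sums, which identifies the unconditional sum.
    rwa [tendsto_nhds_unique (hsum.comp (tendsto_piFinset_range_atTop (N + 1))) hlim] at hsum
  · rw [hb, hG.mulAdjoint_eq_tensorOp_adjoint hT]
  · rw [hw, hG.mulAdjoint_eq_tensorOp_adjoint hT]
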